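/- Let $\lambda$ be an infinite cardinal and let $\kappa=\min\{\nu : \nu \text{ is a cardinal and } 2^{\nu}>2^{\lambda}\}$. Then there is a $T_3$ (that is, regular Hausdorff) topological space $X$ with $|X|=2^{\kappa}$ such that no closed subspace $Y$ of $X$ satisfies $\lambda\le |Y|<2^{\kappa}$. -/

import Mathlib

open scoped Cardinal

universe u

/-! Well-order `X` in type `2 ^ κ` and list the subsets of size `lam` as `A z`, each lying below its
index `z` and each occurring `2 ^ κ` times. If ultrafilters `D z` containing `A z` converge to `z`,
then a closed set including some `B` of size `lam` contains every `z` with `A z = B`, hence has `2 ^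
κ` points.

Such a topology is generated by the sets `V` with `z ∈ V ↔ V ∈ D z`. Enough of these exist to
separate points (`exists_ultrafilter_clopen_separating`) once any `lam` of the ultrafilters have
pairwise disjoint members.

These ultrafilters extend the filters of `exists_isSeparating`, built for `2 ^ (2 ^ χ)` labels by
induction on `χ`. At each stage `χ` labels are treated directly (`ℵ₀`, successor, limit), and an
independent family then raises their number. Minimality of `κ` gives `κ ≤ 2 ^ lam`, so there are
enough labels; `lam < κ` gives `(2 ^ κ) ^ lam = 2 ^ κ` and cofinality above `lam`. -/

/-! ### Independent families and separated filters. -/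

/-- A large independent family of functions. -/
theorem exists_independent_functions (ι Z : Type u) [Infinite ι] (hZ : #Z ≤ 2 ^ #ι) :
    ∃ (Ω : Type u) (g : Z → Ω → ι), #Ω ≤ #ι ∧
      ∀ (F : Finset Z) (v : Z → ι), ∃ ω, ∀ z ∈ F, g z ω = v z := by
  classical
  have hZ' : #Z ≤ #(Set ι) := by rwa [Cardinal.mk_set]
  obtain ⟨code⟩ := Cardinal.le_def _ _ |>.1 hZ'
  -- A point is a finite window together with a finite table; `z` looks up the trace of its code on
  -- the window.
  refine ⟨Finset ι × Finset (Finset ι × ι), fun z ω =>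
    if h : ∃ v, (ω.1.filter (· ∈ code z), v) ∈ ω.2 then h.choose else Classical.arbitrary ι, ?_, ?_⟩
  · simp
  intro F v
  have hd : ∀ z z' : Z, ∃ i : ι, z ≠ z' → ¬ (i ∈ code z ↔ i ∈ code z') := by
    intro z z'
    by_cases h : z = z'
    · exact ⟨Classical.arbitrary ι, fun h' => (h' h).elim⟩
    · have h2 : code z ≠ code z' := fun h' => h (code.injective h')
      by_contra! hc
      exact h2 (Set.ext fun i => (hc i).2)
  choose d hd using hd
  let G : Finset ι := (F ×ˢ F).image fun p => d p.1 p.2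
  have hG : ∀ z ∈ F, ∀ z' ∈ F, G.filter (· ∈ code z) = G.filter (· ∈ code z') → z = z' := by
    intro z hz z' hz' h
    by_contra hne
    have hm : d z z' ∈ G := Finset.mem_image.2 ⟨(z, z'), by simp [hz, hz'], rfl⟩
    apply hd z z' hne
    have := congrArg (d z z' ∈ ·) h
    simpa [hm] using this
  refine ⟨(G, F.image fun z => (G.filter (· ∈ code z), v z)), fun z hz => ?_⟩
  have hex : ∃ w, (G.filter (· ∈ code z), w) ∈ F.image fun z => (G.filter (· ∈ code z), v z) :=
    ⟨v z, Finset.mem_image.2 ⟨z, hz, rfl⟩⟩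
  simp only [hex, dite_true]
  obtain ⟨z', hz', h'⟩ := Finset.mem_image.1 hex.choose_spec
  rw [Prod.mk.injEq] at h'
  rw [← h'.2, hG z' hz' z hz h'.1]

/-- There are many filters on a small set, few of which can always be separated at once. -/
theorem exists_separated_filters (ι K : Type u) [Infinite ι] [Nonempty K] (hK : #K ≤ 2 ^ #ι) :
    ∃ (Ω : Type u) (p : (K → Bool) → Filter Ω), #Ω ≤ #ι ∧ (∀ h, (p h).NeBot) ∧
      ∀ S : Set (K → Bool), #S ≤ #ι → ∃ P : (K → Bool) → Set Ω,
        (∀ h ∈ S, P h ∈ p h) ∧ S.PairwiseDisjoint P := by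
  classical
  have hι : ℵ₀ ≤ #ι := Cardinal.aleph0_le_mk ι
  have hZ : #((ι × ι → K) × (ι → ι × ι → Bool)) ≤ 2 ^ #ι := by
    have h1 : #ι * #ι = #ι := Cardinal.mul_eq_self hι
    have h2 : #K ^ #ι ≤ 2 ^ #ι := by
      calc #K ^ #ι ≤ (2 ^ #ι) ^ #ι := Cardinal.power_le_power_right hK
        _ = 2 ^ #ι := by rw [← Cardinal.power_mul, h1]
    have h3 : (2 ^ #ι : Cardinal.{u}) ^ #ι = 2 ^ #ι := by rw [← Cardinal.power_mul, h1]
    have h4 : #((ι × ι → K) × (ι → ι × ι → Bool)) = #K ^ #ι * (2 ^ #ι) ^ #ι := by simp [h1]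
    rw [h4, h3]
    refine (mul_le_mul' h2 le_rfl).trans (Cardinal.mul_eq_self ?_).le
    exact hι.trans (Cardinal.cantor _).le
  obtain ⟨Ω, g, hΩ, hg⟩ := exists_independent_functions ι _ hZ
  -- `Z` consists of test coordinates and a list of patterns on them; `e Z h` is the position of a
  -- pattern agreeing with `h`.
  let e : ((ι × ι → K) × (ι → ι × ι → Bool)) → (K → Bool) → ι := fun Z h =>
    if hx : ∃ ξ, Z.2 ξ = h ∘ Z.1 then hx.choose else Classical.arbitrary ι
  refine ⟨Ω, fun h => Filter.generate (Set.range fun Z => {ω | g Z ω = e Z h}), hΩ, ?_, ?_⟩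
  · intro h
    rw [Filter.generate_neBot_iff]
    intro t ht hfin
    obtain ⟨F, -, hF, rfl⟩ := Set.exists_subset_image_finite_and.1
      ⟨t, by rwa [Set.image_univ], hfin, rfl⟩
    obtain ⟨ω, hω⟩ := hg hF.toFinset fun Z => e Z h
    refine ⟨ω, ?_⟩
    rintro _ ⟨Z, hZ, rfl⟩
    exact hω Z (hF.mem_toFinset.2 hZ)
  · intro S hS
    rcases S.eq_empty_or_nonempty with rfl | ⟨h₀, hh₀⟩
    · exact ⟨fun _ => ∅, by simp, by simp⟩
    have : Nonempty S := ⟨⟨h₀, hh₀⟩⟩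
    obtain ⟨f⟩ := Cardinal.le_def _ _ |>.1 hS
    let s : ι → S := Function.invFun f
    have hs : Function.Surjective s := Function.invFun_surjective f.injective
    have hd : ∀ q : ι × ι, ∃ k : K, (s q.1 : K → Bool) ≠ s q.2 →
        (s q.1 : K → Bool) k ≠ (s q.2 : K → Bool) k := by
      intro q
      by_contra! hc
      exact (hc (Classical.choice ‹Nonempty K›)).1 (funext fun k => (hc k).2)
    choose D hD using hd
    -- `D` tests a difference for every pair in `S`, so `e Z` is injective on `S` and the fibres of
    -- `g Z` separate.
    let Z : (ι × ι → K) × (ι → ι × ι → Bool) := (D, fun ξ => (s ξ : K → Bool) ∘ D)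
    refine ⟨fun h => {ω | g Z ω = e Z h}, fun h _ => Filter.mem_generate_of_mem ⟨Z, rfl⟩, ?_⟩
    have he : ∀ h ∈ S, (s (e Z h) : K → Bool) = h := by
      intro h hh
      obtain ⟨ξ, hξ⟩ := hs ⟨h, hh⟩
      have hex : ∃ ξ, Z.2 ξ = h ∘ Z.1 := ⟨ξ, by simp [Z, hξ]⟩
      have h1 : e Z h = hex.choose := dif_pos hex
      have h2 := hex.choose_spec
      rw [← h1] at h2
      by_contra hne
      have h3 := hD (e Z h, ξ) (by simpa [hξ] using hne)
      apply h3
      have := congrFun h2 (e Z h, ξ)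
      simpa [Z, hξ] using this
    intro h hh h' hh' hne
    refine Set.disjoint_left.2 fun ω h1 h2 => hne ?_
    rw [← he h hh, ← he h' hh', ← show g Z ω = e Z h from h1, ← show g Z ω = e Z h' from h2]

/-! ### Separating filters and the increase of the number of labels. -/

theorem neBot_bind {α β : Type*} {f : Filter α} [hf : f.NeBot] {m : α → Filter β}
    (hm : ∀ a, (m a).NeBot) : (f.bind m).NeBot := by
  rw [Filter.neBot_iff, Ne, ← Filter.empty_mem_iff_bot, Filter.mem_bind]
  rintro ⟨t, ht, h⟩
  obtain ⟨x, hx⟩ := Filter.nonempty_of_mem ht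
  exact (hm x).ne (Filter.empty_mem_iff_bot.1 (h x hx))

/-- Filters attached to the large subsets of `X` and to labels, such that every choice of few
labels and of a large set for each of them is separated by disjoint members. -/
structure IsSeparating {X L : Type u} (χ : Cardinal.{u}) (E : Set X → L → Filter X) : Prop where
  neBot : ∀ (A : Set X) (l : L), χ ≤ #A → (E A l).NeBot
  small : ∀ (A : Set X) (l : L), χ ≤ #A → ∃ B ⊆ A, #B ≤ χ ∧ B ∈ E A l
  compl_mem : ∀ (A : Set X) (l : L), χ ≤ #A → ∀ N : Set X, #N < χ → Nᶜ ∈ E A l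
  separates : ∀ S : Set L, #S ≤ χ → ∀ c : L → Set X, (∀ l ∈ S, χ ≤ #(c l)) →
    ∃ C : L → Set X, (∀ l ∈ S, C l ∈ E (c l) l) ∧ S.PairwiseDisjoint C

theorem IsSeparating.comp {X L L' : Type u} {χ : Cardinal.{u}} {E : Set X → L → Filter X}
    (hE : IsSeparating χ E) (f : L' ↪ L) : IsSeparating χ fun A l => E A (f l) where
  neBot A l := hE.neBot A (f l)
  small A l := hE.small A (f l)
  compl_mem A l := hE.compl_mem A (f l)
  separates S hS c hc := by
    classical
    obtain ⟨C, hC, hd⟩ := hE.separates (f '' S) (Cardinal.mk_image_le.trans hS)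
      (Function.extend f c fun _ => ∅) (by
        rintro _ ⟨l, hl, rfl⟩
        rw [f.injective.extend_apply]
        exact hc l hl)
    refine ⟨fun l => C (f l), fun l hl => ?_, fun l hl l' hl' hne => ?_⟩
    · simpa [f.injective.extend_apply] using hC _ (Set.mem_image_of_mem f hl)
    · exact hd (Set.mem_image_of_mem f hl) (Set.mem_image_of_mem f hl')
        (fun h => hne (f.injective h))

/-- Few labels suffice to get separating filters with doubly exponentially many labels. -/
theorem exists_isSeparating_of_le_power_power {X : Type u} {χ : Cardinal.{u}} (hχ : ℵ₀ ≤ χ)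
    (h : ∀ L : Type u, #L ≤ χ → ∃ E : Set X → L → Filter X, IsSeparating χ E)
    (L : Type u) (hL : #L ≤ 2 ^ (2 ^ χ : Cardinal.{u})) :
    ∃ E : Set X → L → Filter X, IsSeparating χ E := by
  classical
  obtain ⟨ι, rfl⟩ : ∃ ι : Type u, #ι = χ := ⟨_, Cardinal.mk_out χ⟩
  have : Infinite ι := Cardinal.infinite_iff.2 hχ
  have hL' : #L ≤ #(Set ι → Bool) := by simpa using hL
  obtain ⟨f⟩ := Cardinal.le_def _ _ |>.1 hL'
  suffices hs : ∃ E : Set X → (Set ι → Bool) → Filter X, IsSeparating #ι E by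
    obtain ⟨E, hE⟩ := hs
    exact ⟨_, hE.comp f⟩
  obtain ⟨Ω, p, hΩ, hp, hsep⟩ := exists_separated_filters ι (Set ι) (by simp)
  obtain ⟨E, hE⟩ := h Ω hΩ
  refine ⟨fun A l => (p l).bind fun β => E A β, ⟨fun A l hA => have := hp l
    neBot_bind fun β => hE.neBot A β hA, fun A l hA => ?_,
    fun A l hA N hN => ?_, fun S hS c hc => ?_⟩⟩
  · choose B hBA hBc hB using fun β => hE.small A β hA
    refine ⟨⋃ β, B β, Set.iUnion_subset hBA, ?_, ?_⟩
    · refine (Cardinal.mk_iUnion_le _).trans ?_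
      refine (mul_le_mul' hΩ (ciSup_le' hBc)).trans (Cardinal.mul_eq_self hχ).le
    · exact Filter.mem_bind.2 ⟨Set.univ, Filter.univ_mem, fun β _ =>
        Filter.mem_of_superset (hB β) (Set.subset_iUnion B β)⟩
  · exact Filter.mem_bind.2 ⟨Set.univ, Filter.univ_mem, fun β _ => hE.compl_mem A β hA N hN⟩
  · obtain ⟨P, hP, hPd⟩ := hsep S hS
    have hu : ∀ β, ∃ l, (∃ l' ∈ S, β ∈ P l') → l ∈ S ∧ β ∈ P l := by
      intro β
      by_cases hb : ∃ l' ∈ S, β ∈ P l'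
      · obtain ⟨l', h1, h2⟩ := hb
        exact ⟨l', fun _ => ⟨h1, h2⟩⟩
      · exact ⟨fun _ => true, fun h => (hb h).elim⟩
    -- Each old label `β` serves at most one new label `ℓ β`, and is used with the set chosen for
    -- that label.
    choose ℓ hℓ using hu
    have hℓ' : ∀ l ∈ S, ∀ β ∈ P l, ℓ β = l := fun l hl β hβ => by
      have := hℓ β ⟨l, hl, hβ⟩
      by_contra hne
      exact Set.disjoint_left.1 (hPd this.1 hl hne) this.2 hβ
    obtain ⟨C, hC, hCd⟩ := hE.separates {β | ∃ l ∈ S, β ∈ P l}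
      ((Cardinal.mk_set_le _).trans hΩ) (fun β => c (ℓ β)) (fun β hβ => hc _ (hℓ β hβ).1)
    refine ⟨fun l => ⋃ β ∈ P l, C β, fun l hl => ?_, fun l hl l' hl' hne => ?_⟩
    · refine Filter.mem_bind.2 ⟨P l, hP l hl, fun β hβ => ?_⟩
      have := hC β ⟨l, hl, hβ⟩
      rw [hℓ' l hl β hβ] at this
      exact Filter.mem_of_superset this (Set.subset_biUnion_of_mem (u := C) hβ)
    · refine Set.disjoint_left.2 fun x hx hx' => ?_
      obtain ⟨β, hβ, hx⟩ := Set.mem_iUnion₂.1 hx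
      obtain ⟨β', hβ', hx'⟩ := Set.mem_iUnion₂.1 hx'
      refine Set.disjoint_left.1 (hCd ⟨l, hl, hβ⟩ ⟨l', hl', hβ'⟩ ?_) hx hx'
      rintro rfl
      exact hne ((hℓ' l hl β hβ).symm.trans (hℓ' l' hl' β hβ'))

/-! ### The countable case. -/

/-- Number of points in the blocks before the `i`-th block, which has
`i * (blockSum i + 1) + 1` points. -/
def blockSum : ℕ → ℕ
  | 0 => 0
  | i + 1 => blockSum i + (i * (blockSum i + 1) + 1)

/-- Sets containing all but few points of almost all blocks of the `n`-th column. -/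
def blockFilter {X : Type u} (a : ℕ → X) (n : ℕ) : Filter X where
  sets := {Z | ∃ K, ∀ m ≥ K, {j ∈ Set.Iio (Nat.pair n m * (blockSum (Nat.pair n m) + 1) + 1) |
    a j ∉ Z}.ncard ≤ K * (blockSum (Nat.pair n m) + 1)}
  univ_sets := ⟨0, by simp⟩
  sets_of_superset := by
    rintro Z Z' ⟨K, hK⟩ h
    refine ⟨K, fun m hm => (Set.ncard_le_ncard ?_ ?_).trans (hK m hm)⟩
    · exact fun j hj => ⟨hj.1, fun h' => hj.2 (h h')⟩
    · exact (Set.finite_Iio _).subset fun j hj => hj.1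
  inter_sets := by
    rintro Z Z' ⟨K, hK⟩ ⟨K', hK'⟩
    refine ⟨K + K', fun m hm => ?_⟩
    rw [add_mul]
    refine (Set.ncard_le_ncard ?_ ?_).trans ((Set.ncard_union_le _ _).trans
      (add_le_add (hK m (by omega)) (hK' m (by omega))))
    · rintro j ⟨h1, h2⟩
      by_cases h : a j ∈ Z
      · exact Or.inr ⟨h1, fun h' => h2 ⟨h, h'⟩⟩
      · exact Or.inl ⟨h1, h⟩
    · exact ((Set.finite_Iio _).subset fun j hj => hj.1).union
        ((Set.finite_Iio _).subset fun j hj => hj.1)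

theorem mem_blockFilter {X : Type u} {a : ℕ → X} {n : ℕ} {Z : Set X} :
    Z ∈ blockFilter a n ↔ ∃ K, ∀ m ≥ K,
      {j ∈ Set.Iio (Nat.pair n m * (blockSum (Nat.pair n m) + 1) + 1) |
        a j ∉ Z}.ncard ≤ K * (blockSum (Nat.pair n m) + 1) := Iff.rfl

/-- Label `n` owns the blocks numbered `Nat.pair n m`. Blocks grow so fast that deleting from each
one all earlier blocks, whatever sets they come from, leaves a member of the filter. -/
theorem exists_isSeparating_aleph0 (X L : Type u) (hL : #L ≤ ℵ₀) :
    ∃ E : Set X → L → Filter X, IsSeparating ℵ₀ E := by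
  classical
  obtain ⟨⟨f, hf⟩⟩ : Nonempty (L ↪ ℕ) := by
    have := Cardinal.mk_le_aleph0_iff.1 hL
    obtain ⟨f, hf⟩ := exists_injective_nat L
    exact ⟨⟨f, hf⟩⟩
  rcases isEmpty_or_nonempty X with hX | hX
  · refine ⟨fun _ _ => ⊥, ?_⟩
    have hc : ∀ A : Set X, ¬ ℵ₀ ≤ #A := fun A h => by
      simp [Set.eq_empty_of_isEmpty A, Cardinal.aleph0_ne_zero] at h
    exact ⟨fun A _ h => (hc A h).elim, fun A _ h => (hc A h).elim, fun A _ h => (hc A h).elim,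
      fun S _ c h => ⟨fun _ => ∅, by simp, fun _ _ _ _ _ => by simp⟩⟩
  have ha : ∀ A : Set X, ∃ a : ℕ → X, ℵ₀ ≤ #A → Function.Injective a ∧ ∀ i, a i ∈ A := by
    intro A
    by_cases h : ℵ₀ ≤ #A
    · have := Cardinal.infinite_iff.2 h
      exact ⟨fun i => Infinite.natEmbedding A i, fun _ =>
        ⟨Subtype.val_injective.comp (Infinite.natEmbedding A).injective, fun i => Subtype.prop _⟩⟩
    · exact ⟨fun _ => Classical.arbitrary X, fun h' => (h h').elim⟩
  choose a ha using ha
  refine ⟨fun A l => blockFilter (a A) (f l), ⟨fun A l hA => ?_, fun A l hA => ?_,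
    fun A l hA N hN => ?_, fun S hS c hc => ?_⟩⟩
  · rw [Filter.neBot_iff, Ne, ← Filter.empty_mem_iff_bot, mem_blockFilter]
    rintro ⟨K, hK⟩
    -- Block `Nat.pair (f l) K` has index at least `K`, so it has more points than the allowed loss.
    have h := hK K le_rfl
    simp only [Set.mem_empty_iff_false, not_false_eq_true, and_true, Set.ofPred_mem_eq,
      Set.ncard_Iio_nat] at h
    have := Nat.mul_le_mul_right (blockSum (Nat.pair (f l) K) + 1) (Nat.right_le_pair (f l) K)
    omega
  · refine ⟨Set.range (a A), Set.range_subset_iff.2 (ha A hA).2, ?_, ⟨0, ?_⟩⟩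
    · exact (Set.countable_range _).le_aleph0
    · simp
  · have hN' : N.Finite := Cardinal.lt_aleph0_iff_set_finite.1 hN
    refine ⟨N.ncard, fun m _ => ?_⟩
    refine le_trans ?_ (Nat.le_mul_of_pos_right _ (Nat.succ_pos _))
    refine Set.ncard_le_ncard_of_injOn (a A) ?_ (ha A hA).1.injOn hN'
    rintro j ⟨-, hj⟩
    simpa using hj
  · let c' : ℕ → Set X := Function.extend f c fun _ => ∅
    let D : ℕ → Finset X := fun i =>
      (Finset.range (i * (blockSum i + 1) + 1)).image (a (c' (Nat.unpair i).1))
    let U : ℕ → Finset X := fun i => (Finset.range i).biUnion D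
    have hU : ∀ i, (U i).card ≤ blockSum i := by
      intro i
      induction i with
      | zero => simp [U]
      | succ i ih =>
        have : U (i + 1) = U i ∪ D i := by
          simp only [U, Finset.range_add_one, Finset.biUnion_insert]
          rw [Finset.union_comm]
        rw [this, blockSum]
        refine (Finset.card_union_le _ _).trans (add_le_add ih ?_)
        exact Finset.card_image_le.trans (by simp)
    refine ⟨fun l => ⋃ m, ((D (Nat.pair (f l) m) : Set X) \ U (Nat.pair (f l) m)),
      fun l hl => ⟨1, fun m _ => ?_⟩, fun l hl l' hl' hne => ?_⟩
    · rw [one_mul]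
      refine le_trans ?_ ((hU _).trans (Nat.le_succ _))
      rw [← Set.ncard_coe_finset]
      refine Set.ncard_le_ncard_of_injOn (a (c l)) ?_ (ha _ (hc l hl)).1.injOn (Finset.finite_toSet _)
      rintro j ⟨hj, hj'⟩
      by_contra hU'
      refine hj' (Set.mem_iUnion.2 ⟨m, ?_, hU'⟩)
      simp only [D, Nat.unpair_pair, c', hf.extend_apply]
      exact Finset.mem_coe.2 (Finset.mem_image_of_mem _ (Finset.mem_range.2 hj))
    · refine Set.disjoint_left.2 fun x hx hx' => ?_
      obtain ⟨m, hx, hxU⟩ := Set.mem_iUnion.1 hx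
      obtain ⟨m', hx', hxU'⟩ := Set.mem_iUnion.1 hx'
      have h1 : ∀ i j, i < j → x ∈ D i → x ∉ U j → False := fun i j hij hi hj =>
        hj (Finset.mem_biUnion.2 ⟨i, Finset.mem_range.2 hij, hi⟩)
      rcases lt_trichotomy (Nat.pair (f l) m) (Nat.pair (f l') m') with h | h | h
      · exact h1 _ _ h hx hxU'
      · exact hne (hf (Nat.pair_eq_pair.1 h).1)
      · exact h1 _ _ h hx' hxU

/-! ### Cardinal bounds and disjoint pieces. -/

theorem mk_iUnion_le_of_le {ι X : Type u} {χ : Cardinal.{u}} (hχ : ℵ₀ ≤ χ) (hι : #ι ≤ χ)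
    {f : ι → Set X} (hf : ∀ i, #(f i) ≤ χ) : #(⋃ i, f i) ≤ χ :=
  (Cardinal.mk_iUnion_le _).trans
    ((mul_le_mul' hι (ciSup_le' hf)).trans (Cardinal.mul_eq_self hχ).le)

theorem mk_biUnion_le_of_le {ι X : Type u} {χ : Cardinal.{u}} (hχ : ℵ₀ ≤ χ) {S : Set ι}
    (hS : #S ≤ χ) {f : ι → Set X} (hf : ∀ i ∈ S, #(f i) ≤ χ) : #(⋃ i ∈ S, f i) ≤ χ := by
  rw [Set.biUnion_eq_iUnion]
  exact mk_iUnion_le_of_le hχ hS fun i => hf i i.2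

/-- The points reachable from `S` along the relation `R`. -/
def reachable {X : Type u} (R : X → X → Prop) (S : Set X) : Set X :=
  {b | ∃ a ∈ S, Relation.ReflTransGen R a b}

theorem subset_reachable {X : Type u} (R : X → X → Prop) (S : Set X) : S ⊆ reachable R S :=
  fun a ha => ⟨a, ha, .refl⟩

theorem reachable_tail {X : Type u} {R : X → X → Prop} {S : Set X} {a b : X}
    (ha : a ∈ reachable R S) (h : R a b) : b ∈ reachable R S :=
  ha.imp fun _ hs => ⟨hs.1, hs.2.tail h⟩

theorem reachable_mono {X : Type u} {R R' : X → X → Prop} {S S' : Set X}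
    (h : ∀ a b, R a b → R' a b) (hS : S ⊆ S') : reachable R S ⊆ reachable R' S' := by
  rintro b ⟨a, ha, hab⟩
  exact ⟨a, hS ha, Relation.ReflTransGen.mono h _ _ hab⟩

theorem mk_reachable_le {X : Type u} {χ : Cardinal.{u}} (hχ : ℵ₀ ≤ χ) {R : X → X → Prop}
    {S : Set X} (hS : #S ≤ χ) (hR : ∀ a, #{b | R a b} ≤ χ) : #(reachable R S) ≤ χ := by
  obtain ⟨T, hT0, hTs⟩ : ∃ T : ℕ → Set X, T 0 = S ∧ ∀ n, T (n + 1) = ⋃ a ∈ T n, {b | R a b} :=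
    ⟨fun n => Nat.rec S (fun _ A => ⋃ a ∈ A, {b | R a b}) n, rfl, fun _ => rfl⟩
  have hT : ∀ n : ℕ, #(T n) ≤ χ := by
    intro n
    induction n with
    | zero => exact hT0 ▸ hS
    | succ n ih =>
      rw [hTs]
      exact mk_biUnion_le_of_le hχ ih fun a _ => hR a
  have hsub : reachable R S ⊆ ⋃ n : ULift.{u} ℕ, T n.down := by
    rintro b ⟨a, ha, hab⟩
    induction hab with
    | refl => exact Set.mem_iUnion.2 ⟨⟨0⟩, by simpa [hT0] using ha⟩
    | @tail b c _ hbc ih =>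
      obtain ⟨n, hn⟩ := Set.mem_iUnion.1 ih
      exact Set.mem_iUnion.2 ⟨⟨n.down + 1⟩, by
        rw [hTs]
        exact Set.mem_iUnion₂.2 ⟨b, hn, hbc⟩⟩
  exact (Cardinal.mk_le_mk_of_subset hsub).trans
    (mk_iUnion_le_of_le hχ (by simpa using hχ) fun n => hT n.down)

theorem mk_setOf_inter_nonempty_le {ι X : Type u} {f : ι → Set X}
    (hf : Pairwise (Function.onFun Disjoint f)) (T : Set X) :
    #{i | (f i ∩ T).Nonempty} ≤ #T := by
  choose g hg using fun i : {i | (f i ∩ T).Nonempty} => i.2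
  refine Cardinal.mk_le_of_injective (f := fun i => (⟨g i, (hg i).2⟩ : T)) fun i j hij => ?_
  by_contra hne
  have h : g i = g j := congrArg Subtype.val hij
  exact Set.disjoint_left.1 (hf fun h' => hne (Subtype.ext h')) (hg i).1 (h ▸ (hg j).1)

theorem exists_disjoint_subsets {X W : Type u} {χ : Cardinal.{u}} (A : Set X)
    (hA : #W * χ ≤ #A) : ∃ B : W → Set X,
      Pairwise (Function.onFun Disjoint B) ∧ ∀ w, B w ⊆ A ∧ #(B w) = χ := by
  have hA' : #(W × χ.out) ≤ #A := by simpa using hA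
  obtain ⟨f⟩ := Cardinal.le_def _ _ |>.1 hA'
  refine ⟨fun w => Set.range fun i => (f (w, i) : X), fun w w' hne => ?_, fun w => ⟨?_, ?_⟩⟩
  · refine Set.disjoint_left.2 ?_
    rintro _ ⟨i, rfl⟩ ⟨j, hj⟩
    exact hne (congrArg Prod.fst (f.injective (Subtype.ext hj))).symm
  · rintro _ ⟨i, rfl⟩
    exact (f (w, i)).2
  · rw [Cardinal.mk_range_eq _ fun i j hij =>
      congrArg Prod.snd (f.injective (Subtype.ext hij)), Cardinal.mk_out]

/-! ### The successor case. -/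

/-- Cut each large set into `succ χ` disjoint pieces of size `χ` and take the limit over pieces of
filters labelled by (label, piece). An increasing chain of sets of size `χ` sorts almost all pieces
into layers of at most `χ` pieces, and each layer is separated by the hypothesis for `χ`. -/
theorem exists_isSeparating_succ {X : Type u} {χ : Cardinal.{u}} (hχ : ℵ₀ ≤ χ)
    (h : ∀ L : Type u, #L ≤ 2 ^ (2 ^ χ : Cardinal.{u}) →
      ∃ E : Set X → L → Filter X, IsSeparating χ E)
    (L : Type u) (hL : #L ≤ Order.succ χ) :
    ∃ E : Set X → L → Filter X, IsSeparating (Order.succ χ) E := by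
  classical
  have hχs : χ < Order.succ χ := Order.lt_succ χ
  have hs : ℵ₀ ≤ Order.succ χ := hχ.trans hχs.le
  let W := (Order.succ χ).ord.ToType
  have hW : #W = Order.succ χ := Cardinal.mk_ord_toType _
  have hIio : ∀ w : W, #(Set.Iio w) ≤ χ := fun w =>
    Order.lt_succ_iff.1 ((Cardinal.mk_Iio_lt w (by simp [W])).trans_eq hW)
  have : NoMaxOrder W := Cardinal.noMaxOrder hs
  obtain ⟨f⟩ := Cardinal.le_def _ _ |>.1 (hL.trans_eq hW.symm)
  suffices hs : ∃ E : Set X → W → Filter X, IsSeparating (Order.succ χ) E by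
    obtain ⟨E, hE⟩ := hs
    exact ⟨_, hE.comp f⟩
  obtain ⟨E, hE⟩ := h (W × W) (by
    rw [Cardinal.mk_prod, Cardinal.lift_id, hW, Cardinal.mul_eq_self hs]
    exact (Order.succ_le_of_lt (Cardinal.cantor χ)).trans (Cardinal.cantor _).le)
  have hB : ∀ A : Set X, ∃ B : W → Set X, Pairwise (Function.onFun Disjoint B) ∧
      (Order.succ χ ≤ #A → ∀ w, B w ⊆ A ∧ #(B w) = χ) := by
    intro A
    by_cases hA : Order.succ χ ≤ #A
    · obtain ⟨B, h1, h2⟩ := exists_disjoint_subsets (W := W) (χ := χ) A (by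
        rw [hW, Cardinal.mul_eq_left hs hχs.le (Cardinal.aleph0_pos.trans_le hχ).ne']
        exact hA)
      exact ⟨B, h1, fun _ => h2⟩
    · exact ⟨fun _ => ∅, fun _ _ _ => by simp [Function.onFun], fun h => (hA h).elim⟩
  choose B hBd hB using hB
  have hBE : ∀ A : Set X, Order.succ χ ≤ #A → ∀ w l, B A w ∈ E (B A w) l := by
    intro A hA w l
    obtain ⟨B', h1, -, h2⟩ := hE.small (B A w) l (hB A hA w).2.ge
    exact Filter.mem_of_superset h2 h1
  let 𝓕 : Filter W := Filter.cocardinal W (Cardinal.isRegular_succ hχ)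
  have h𝓕 : ∀ s : Set W, #s ≤ χ → sᶜ ∈ 𝓕 := by
    intro s hs
    rw [Filter.mem_cocardinal, compl_compl]
    exact Order.lt_succ_iff.2 hs
  have : 𝓕.NeBot := by
    rw [Filter.neBot_iff, Ne, ← Filter.empty_mem_iff_bot, Filter.mem_cocardinal]
    simp [hW]
  refine ⟨fun A α => 𝓕.bind fun γ => E (B A γ) (α, γ), ⟨fun A α hA => neBot_bind fun γ =>
    hE.neBot _ _ (hB A hA γ).2.ge, fun A α hA => ?_, fun A α hA N hN => ?_, fun S hS c hc => ?_⟩⟩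
  · refine ⟨⋃ γ, B A γ, Set.iUnion_subset fun γ => (hB A hA γ).1,
      mk_iUnion_le_of_le hs hW.le fun γ => (hB A hA γ).2.trans_le hχs.le, ?_⟩
    exact Filter.mem_bind.2 ⟨_, Filter.univ_mem, fun γ _ =>
      Filter.mem_of_superset (hBE A hA γ _) (Set.subset_iUnion _ γ)⟩
  · refine Filter.mem_bind.2 ⟨_, h𝓕 _ ((mk_setOf_inter_nonempty_le (hBd A) N).trans
      (Order.lt_succ_iff.1 hN)), fun γ hγ => Filter.mem_of_superset (hBE A hA γ _) fun x hx hxN =>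
        hγ ⟨x, hx, hxN⟩⟩
  let b : W × W → Set X := fun p => if p.1 ∈ S then B (c p.1) p.2 else ∅
  have hb : ∀ p, p.1 ∈ S → b p = B (c p.1) p.2 := fun p hp => if_pos hp
  have hbχ : ∀ p, #(b p) ≤ χ := by
    intro p
    by_cases hp : p.1 ∈ S
    · rw [hb p hp]
      exact (hB _ (hc _ hp) _).2.le
    · simp [b, hp]
  have hbd : ∀ α, Pairwise (Function.onFun Disjoint fun γ => b (α, γ)) := by
    intro α γ γ' hne
    by_cases hα : α ∈ S
    · simpa [Function.onFun, b, hα] using hBd (c α) hne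
    · simp [Function.onFun, b, hα]
  -- For each `α` at most one piece passes through a given point, so closing under pieces with `α <
  -- δ` keeps size `χ`.
  let R : W → X → X → Prop := fun δ a a' => ∃ p, p.1 < δ ∧ a ∈ b p ∧ a' ∈ b p
  let T : W → Set X := fun δ => reachable (R δ) (⋃ p ∈ Set.Iio δ ×ˢ Set.Iio δ, b p)
  have hTmono : Monotone T := by
    intro δ δ' hδ
    refine reachable_mono (fun a b ⟨p, hp, hab⟩ => ⟨p, hp.trans_le hδ, hab⟩) ?_
    exact Set.biUnion_subset_biUnion_left
      (Set.prod_mono (Set.Iio_subset_Iio hδ) (Set.Iio_subset_Iio hδ))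
  have hTsat : ∀ δ p, p.1 < δ → ∀ a ∈ b p, a ∈ T δ → b p ⊆ T δ := fun δ p hp a ha haT a' ha' =>
    reachable_tail haT ⟨p, hp, ha, ha'⟩
  have hTex : ∀ p, ∀ a ∈ b p, ∃ δ, a ∈ T δ := by
    intro p a ha
    obtain ⟨δ, hδ⟩ := exists_gt (max p.1 p.2)
    exact ⟨δ, subset_reachable _ _ (Set.mem_iUnion₂.2
      ⟨p, ⟨(le_max_left _ _).trans_lt hδ, (le_max_right _ _).trans_lt hδ⟩, ha⟩)⟩
  have hTχ : ∀ δ, #(T δ) ≤ χ := by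
    intro δ
    refine mk_reachable_le hχ (mk_biUnion_le_of_le hχ ?_ fun p _ => hbχ p) fun a => ?_
    · rw [Cardinal.mk_setProd]
      exact (mul_le_mul' (hIio δ) (hIio δ)).trans (Cardinal.mul_eq_self hχ).le
    · refine (Cardinal.mk_le_mk_of_subset (t := ⋃ α ∈ Set.Iio δ,
        ⋃ γ ∈ {γ | (b (α, γ) ∩ {a}).Nonempty}, b (α, γ)) ?_).trans
        (mk_biUnion_le_of_le hχ (hIio δ) fun α _ => mk_biUnion_le_of_le hχ
          ((mk_setOf_inter_nonempty_le (hbd α) {a}).trans ?_) fun γ _ => hbχ _)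
      · rintro a' ⟨⟨α, γ⟩, hp, ha, ha'⟩
        exact Set.mem_iUnion₂.2 ⟨α, hp, Set.mem_iUnion₂.2 ⟨γ, ⟨a, ha, rfl⟩, ha'⟩⟩
      · simpa using Cardinal.one_le_aleph0.trans hχ
  have hd : ∀ a, ∃ δ, (∃ δ', a ∈ T δ') → a ∈ T δ ∧ ∀ δ', a ∈ T δ' → δ ≤ δ' := by
    intro a
    by_cases ha : ∃ δ', a ∈ T δ'
    · obtain ⟨m, hm, hmin⟩ := WellFounded.has_min (wellFounded_lt (α := W)) {δ | a ∈ T δ} ha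
      exact ⟨m, fun _ => ⟨hm, fun δ' h' => not_lt.1 (hmin δ' h')⟩⟩
    · obtain ⟨w⟩ := Cardinal.mk_ne_zero_iff.1 (hW.trans_ne (Cardinal.aleph0_pos.trans_le hs).ne')
      exact ⟨w, fun h => (ha h).elim⟩
  choose d hd using hd
  -- A good piece enters the chain after stage `p.1` and then all at once, so `d` is constant on it.
  -- For each label at most `χ` pieces are bad.
  let good : W × W → Prop := fun p => Disjoint (b p) (T p.1)
  have hgood : ∀ p, good p → ∀ a ∈ b p, p.1 < d a := by
    intro p hp a ha
    by_contra! hle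
    exact Set.disjoint_left.1 hp ha (hTmono hle (hd a (hTex p a ha)).1)
  have hdle : ∀ p, good p → ∀ a ∈ b p, ∀ a' ∈ b p, d a ≤ d a' := by
    intro p hp a ha a' ha'
    exact (hd a (hTex p a ha)).2 _
      (hTsat _ p (hgood p hp a' ha') a' ha' (hd a' (hTex p a' ha')).1 ha)
  let Q : W → Set (W × W) := fun δ => {p | p.1 ∈ S ∧ p.1 < δ ∧ (b p ∩ T δ).Nonempty}
  have hQ : ∀ δ, #(Q δ) ≤ χ := by
    intro δ
    refine (Cardinal.mk_le_mk_of_subset (t := ⋃ α ∈ Set.Iio δ,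
      Prod.mk α '' {γ | (b (α, γ) ∩ T δ).Nonempty}) ?_).trans
      (mk_biUnion_le_of_le hχ (hIio δ) fun α _ => Cardinal.mk_image_le.trans
        ((mk_setOf_inter_nonempty_le (hbd α) _).trans (hTχ δ)))
    rintro ⟨α, γ⟩ ⟨-, hp, h⟩
    exact Set.mem_iUnion₂.2 ⟨α, hp, γ, h, rfl⟩
  choose C hC hCd using fun δ => hE.separates (Q δ) (hQ δ) b (fun p hp => by
    rw [hb p hp.1]
    exact (hB _ (hc _ hp.1) _).2.ge)
  refine ⟨fun α => ⋃ γ, {a ∈ b (α, γ) | good (α, γ) ∧ a ∈ C (d a) (α, γ)}, fun α hα => ?_,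
    fun α hα α' hα' hne => ?_⟩
  · refine Filter.mem_bind.2 ⟨_, h𝓕 _ ((mk_setOf_inter_nonempty_le (hbd α) (T α)).trans (hTχ α)),
      fun γ hγ => ?_⟩
    have hg : good (α, γ) := Set.disjoint_iff_inter_eq_empty.2 (Set.not_nonempty_iff_eq_empty.1 hγ)
    have hbB : b (α, γ) = B (c α) γ := hb _ hα
    have hmem := hBE (c α) (hc α hα) γ (α, γ)
    have := hE.neBot (B (c α) γ) (α, γ) (hB _ (hc α hα) γ).2.ge
    obtain ⟨a₀, ha₀⟩ := Filter.nonempty_of_mem hmem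
    rw [← hbB] at ha₀
    have hCm := hC (d a₀) (α, γ)
      ⟨hα, hgood _ hg a₀ ha₀, a₀, ha₀, (hd a₀ (hTex _ a₀ ha₀)).1⟩
    rw [hbB] at hCm
    refine Filter.mem_of_superset (Filter.inter_mem hmem hCm) fun a ha => ?_
    have hab : a ∈ b (α, γ) := hbB ▸ ha.1
    refine Set.mem_iUnion.2 ⟨γ, hab, hg, ?_⟩
    rw [(hdle _ hg a hab a₀ ha₀).antisymm (hdle _ hg a₀ ha₀ a hab)]
    exact ha.2
  · refine Set.disjoint_left.2 fun a ha ha' => ?_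
    obtain ⟨γ, hab, hg, haC⟩ := Set.mem_iUnion.1 ha
    obtain ⟨γ', hab', hg', haC'⟩ := Set.mem_iUnion.1 ha'
    exact Set.disjoint_left.1 (hCd (d a)
      ⟨hα, hgood _ hg a hab, a, hab, (hd a (hTex _ a hab)).1⟩
      ⟨hα', hgood _ hg' a hab', a, hab', (hd a (hTex _ a hab)).1⟩
      fun h => hne (congrArg Prod.fst h)) haC haC'

/-! ### The limit case and the induction. -/

theorem exists_le_mk_Iio {χ ν : Cardinal.{u}} (h : ν < χ) :
    ∃ w : χ.ord.ToType, ν ≤ #(Set.Iio w) := by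
  have h' : ν.ord < Ordinal.type (fun x y : χ.ord.ToType => x < y) := by
    simpa using Cardinal.ord_lt_ord.2 h
  refine ⟨Ordinal.enum (fun x y : χ.ord.ToType => x < y) ⟨ν.ord, h'⟩, ?_⟩
  have := Ordinal.card_typein (r := fun x y : χ.ord.ToType => x < y)
    (Ordinal.enum (fun x y : χ.ord.ToType => x < y) ⟨ν.ord, h'⟩)
  rw [Ordinal.typein_enum, Cardinal.card_ord] at this
  exact this.le

/-- Take the limit of separating filters of smaller cardinals. Stage `w` handles the labels below
`w` with small sets, and the union of all earlier stages is small enough to be removed. -/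
theorem exists_isSeparating_limit {X : Type u} {χ : Cardinal.{u}} (hχ : ℵ₀ < χ)
    (hlim : ∀ ν < χ, Order.succ ν < χ)
    (h : ∀ ν < χ, ℵ₀ ≤ ν → ∀ L : Type u, #L ≤ 2 ^ (2 ^ ν : Cardinal.{u}) →
      ∃ E : Set X → L → Filter X, IsSeparating ν E)
    (L : Type u) (hL : #L ≤ χ) :
    ∃ E : Set X → L → Filter X, IsSeparating χ E := by
  classical
  let W := χ.ord.ToType
  have hW : #W = χ := Cardinal.mk_ord_toType _
  let k : W → Cardinal.{u} := fun w => #(Set.Iio w)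
  have hk : ∀ w, k w < χ := fun w => (Cardinal.mk_Iio_lt w (by simp [W])).trans_eq hW
  have hkmono : Monotone k := fun v w hvw => Cardinal.mk_le_mk_of_subset (Set.Iio_subset_Iio hvw)
  obtain ⟨f⟩ := Cardinal.le_def _ _ |>.1 (hL.trans_eq hW.symm)
  suffices hs : ∃ E : Set X → W → Filter X, IsSeparating χ E by
    obtain ⟨E, hE⟩ := hs
    exact ⟨_, hE.comp f⟩
  have : Nonempty W := Cardinal.mk_ne_zero_iff.1 (hW.trans_ne (Cardinal.aleph0_pos.trans hχ).ne')
  -- These are the positions of the infinite cardinals below `χ`.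
  let I : Set W := {w | ℵ₀ ≤ k w ∧ ∀ v < w, k v < k w}
  have hI : ∀ v, ∃ w ∈ I, v < w := by
    intro v
    obtain ⟨w, hw, hmin⟩ := WellFounded.has_min (wellFounded_lt (α := W))
      {w | Order.succ (max ℵ₀ (k v)) ≤ k w} (exists_le_mk_Iio (hlim _ (max_lt hχ (hk v))))
    have hm := Order.lt_succ (max ℵ₀ (k v))
    refine ⟨w, ⟨((le_max_left _ _).trans_lt hm).le.trans hw, fun v' hv' => ?_⟩, ?_⟩
    · exact (not_le.1 fun h' => hmin v' h' hv').trans_le hw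
    · by_contra! hle
      exact (((le_max_right _ _).trans_lt hm).trans_le hw).not_ge (hkmono hle)
  let 𝓖 : Filter W := Filter.atTop ⊓ Filter.principal I
  have h𝓖 : ∀ v, {w | w ∈ I ∧ v < w} ∈ 𝓖 := by
    intro v
    obtain ⟨v', -, hv'⟩ := hI v
    exact Filter.mem_of_superset (Filter.inter_mem_inf (Filter.mem_atTop v')
      (Filter.mem_principal_self I)) fun w hw => ⟨hw.2, hv'.trans_le hw.1⟩
  have : 𝓖.NeBot := by
    rw [Filter.inf_principal_neBot_iff]
    intro U hU
    obtain ⟨v, hv⟩ := Filter.mem_atTop_sets.1 hU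
    obtain ⟨w, hwI, hw⟩ := hI v
    exact ⟨w, hv w hw.le, hwI⟩
  have hE : ∀ w : W, ∃ E : Set X → Set.Iio w → Filter X,
      w ∈ I → IsSeparating (Order.succ (k w)) E := by
    intro w
    by_cases hw : w ∈ I
    -- With threshold `succ (k w)` instead of `k w`, sets of size `k w`, such as `N w` below, are
    -- negligible.
    · obtain ⟨E, hE⟩ := h _ (hlim _ (hk w)) (hw.1.trans (Order.le_succ _)) (Set.Iio w)
        ((Order.le_succ (k w)).trans
          ((Cardinal.cantor _).le.trans (Cardinal.cantor _).le))
      exact ⟨E, fun _ => hE⟩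
    · exact ⟨fun _ _ => ⊥, fun h => (hw h).elim⟩
  choose E hE using hE
  let G : Set X → W → W → Filter X := fun A l w =>
    if hw : l < w then (if w ∈ I then E w A ⟨l, hw⟩ else ⊤) else ⊤
  have hG : ∀ A l w (hw : l < w), w ∈ I → G A l w = E w A ⟨l, hw⟩ := fun A l w hw hwI => by
    simp [G, hw, hwI]
  have hle : ∀ w, Order.succ (k w) ≤ χ := fun w => (hlim _ (hk w)).le
  refine ⟨fun A l => 𝓖.bind (G A l), ⟨fun A l hA => ?_, fun A l hA => ?_, fun A l hA N hN => ?_,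
    fun S _ c hc => ?_⟩⟩
  · have : Nonempty X := by
      obtain ⟨a⟩ := Cardinal.mk_ne_zero_iff.1 ((Cardinal.aleph0_pos.trans hχ).trans_le hA).ne'
      exact ⟨a⟩
    refine neBot_bind fun w => ?_
    by_cases hw : l < w
    · by_cases hwI : w ∈ I
      · rw [hG A l w hw hwI]
        exact (hE w hwI).neBot A _ ((hle w).trans hA)
      · simp only [G, hw, hwI, dite_true, if_false]
        infer_instance
    · simp only [G, hw, dite_false]
      infer_instance
  · have hB : ∀ w, ∃ B ⊆ A, #B ≤ χ ∧ (w ∈ I ∧ l < w → B ∈ G A l w) := by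
      intro w
      by_cases hw : w ∈ I ∧ l < w
      · obtain ⟨B, h1, h2, h3⟩ := (hE w hw.1).small A ⟨l, hw.2⟩ ((hle w).trans hA)
        exact ⟨B, h1, h2.trans (hle w), fun _ => by rwa [hG A l w hw.2 hw.1]⟩
      · exact ⟨∅, by simp, by simp, fun h => (hw h).elim⟩
    choose B hBA hBχ hB using hB
    exact ⟨⋃ w, B w, Set.iUnion_subset hBA, mk_iUnion_le_of_le hχ.le hW.le hBχ,
      Filter.mem_bind.2 ⟨_, h𝓖 l, fun w hw =>
        Filter.mem_of_superset (hB w hw) (Set.subset_iUnion B w)⟩⟩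
  · obtain ⟨v, hv⟩ := exists_le_mk_Iio hN
    refine Filter.mem_bind.2 ⟨_, h𝓖 (max l v), fun w hw => ?_⟩
    rw [hG A l w ((le_max_left _ _).trans_lt hw.2) hw.1]
    exact (hE w hw.1).compl_mem A _ ((hle w).trans hA) N
      (Order.lt_succ_iff.2 (hv.trans (hkmono ((le_max_right _ _).trans_lt hw.2).le)))
  have hC : ∀ w, ∃ C : W → Set X, w ∈ I →
      (∀ l ∈ S, l < w → C l ∈ G (c l) l w ∧ #(C l) ≤ Order.succ (k w)) ∧
      ∀ l ∈ S, l < w → ∀ l' ∈ S, l' < w → l ≠ l' → Disjoint (C l) (C l') := by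
    intro w
    by_cases hw : w ∈ I
    swap
    · exact ⟨fun _ => ∅, fun h => (hw h).elim⟩
    obtain ⟨C, hC, hCd⟩ := (hE w hw).separates {l | l.1 ∈ S}
      ((Cardinal.mk_set_le _).trans (Order.le_succ _)) (fun l => c l)
      (fun l hl => (hle w).trans (hc _ hl))
    have hB : ∀ l, ∃ B : Set X, ∀ (hl : l < w), l ∈ S →
        #B ≤ Order.succ (k w) ∧ B ∈ E w (c l) ⟨l, hl⟩ := by
      intro l
      by_cases hl : l < w ∧ l ∈ S
      · obtain ⟨B, -, h2⟩ := (hE w hw).small (c l) ⟨l, hl.1⟩ ((hle w).trans (hc l hl.2))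
        exact ⟨B, fun _ _ => h2⟩
      · exact ⟨∅, fun h1 h2 => (hl ⟨h1, h2⟩).elim⟩
    choose B hB using hB
    refine ⟨fun l => if hl : l < w then C ⟨l, hl⟩ ∩ B l else ∅, fun _ => ⟨fun l hl hlw => ?_,
      fun l hl hlw l' hl' hlw' hne => ?_⟩⟩
    · simp only [dif_pos hlw]
      rw [hG _ _ _ hlw hw]
      exact ⟨Filter.inter_mem (hC ⟨l, hlw⟩ hl) (hB l hlw hl).2,
        (Cardinal.mk_le_mk_of_subset Set.inter_subset_right).trans (hB l hlw hl).1⟩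
    · simp only [dif_pos hlw, dif_pos hlw']
      exact (hCd (x := ⟨l, hlw⟩) hl (y := ⟨l', hlw'⟩) hl' fun h => hne (congrArg Subtype.val h)).mono
        Set.inter_subset_left Set.inter_subset_left
  choose C hC using hC
  let N : W → Set X := fun w => ⋃ v ∈ {v | v < w ∧ v ∈ I}, ⋃ l ∈ {l | l < v ∧ l ∈ S}, C v l
  have hN : ∀ w ∈ I, #(N w) ≤ k w := by
    intro w hw
    refine mk_biUnion_le_of_le hw.1 (Cardinal.mk_le_mk_of_subset fun v hv => hv.1) fun v hv => ?_
    refine mk_biUnion_le_of_le hw.1 ((Cardinal.mk_le_mk_of_subset fun l hl => hl.1).trans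
      (hkmono hv.1.le)) fun l hl => ?_
    exact (((hC v hv.2).1 l hl.2 hl.1).2).trans (Order.succ_le_of_lt (hw.2 v hv.1))
  refine ⟨fun l => ⋃ w ∈ {w | w ∈ I ∧ l < w}, C w l \ N w, fun l hl => ?_,
    fun l hl l' hl' hne => ?_⟩
  · refine Filter.mem_bind.2 ⟨_, h𝓖 l, fun w hw => ?_⟩
    refine Filter.mem_of_superset (Filter.inter_mem ((hC w hw.1).1 l hl hw.2).1 ?_)
      (Set.subset_biUnion_of_mem (u := fun w => C w l \ N w) hw)
    rw [hG _ _ _ hw.2 hw.1]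
    exact (hE w hw.1).compl_mem _ _ ((hle w).trans (hc l hl)) _
      (Order.lt_succ_iff.2 (hN w hw.1))
  · refine Set.disjoint_left.2 fun x hx hx' => ?_
    obtain ⟨w, hw, hxC, hxN⟩ := Set.mem_iUnion₂.1 hx
    obtain ⟨w', hw', hxC', hxN'⟩ := Set.mem_iUnion₂.1 hx'
    rcases lt_trichotomy w w' with hlt | rfl | hlt
    · exact hxN' (Set.mem_iUnion₂.2 ⟨w, ⟨hlt, hw.1⟩, Set.mem_iUnion₂.2 ⟨l, ⟨hw.2, hl⟩, hxC⟩⟩)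
    · exact Set.disjoint_left.1 ((hC w hw.1).2 l hl hw.2 l' hl' hw'.2 hne) hxC hxC'
    · exact hxN (Set.mem_iUnion₂.2 ⟨w', ⟨hlt, hw'.1⟩, Set.mem_iUnion₂.2 ⟨l', ⟨hw'.2, hl'⟩, hxC'⟩⟩)

theorem exists_isSeparating (X : Type u) {χ : Cardinal.{u}} (hχ : ℵ₀ ≤ χ)
    (L : Type u) (hL : #L ≤ 2 ^ (2 ^ χ : Cardinal.{u})) :
    ∃ E : Set X → L → Filter X, IsSeparating χ E := by
  induction χ using WellFoundedLT.induction generalizing L with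
  | ind χ ih =>
  refine exists_isSeparating_of_le_power_power hχ (fun L hL => ?_) L hL
  rcases hχ.eq_or_lt with rfl | hχ'
  · exact exists_isSeparating_aleph0 X L hL
  by_cases hs : ∃ ν < χ, χ ≤ Order.succ ν
  · obtain ⟨ν, hν, hle⟩ := hs
    obtain rfl : χ = Order.succ ν := hle.antisymm (Order.succ_le_of_lt hν)
    have hν' : ℵ₀ ≤ ν := Order.lt_succ_iff.1 hχ'
    exact exists_isSeparating_succ hν' (fun L hL => ih ν hν hν' L hL) L hL
  · push Not at hs
    exact exists_isSeparating_limit hχ' hs (fun ν hν hν' L hL => ih ν hν hν' L hL) L hL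

/-! ### Indexing of subsets and the topology. -/

/-- Enumerating the subsets of cardinality `lam` of a linear order, each of them often. -/
theorem exists_indexing_of_subsets {X : Type u} [LinearOrder X] {lam : Cardinal.{u}}
    (hX : ℵ₀ ≤ #X) (hpow : #X ^ lam ≤ #X) (hIio : ∀ x : X, #(Set.Iio x) < #X)
    (hcof : lam < Order.cof X) :
    ∃ (N : Set X) (A : X → Set X), (∀ x ∈ N, #(A x) = lam ∧ ∀ a ∈ A x, a < x) ∧
      ∀ B : Set X, #B = lam → #X ≤ #{x | x ∈ N ∧ A x = B} := by
  classical
  have hP : #{B : Set X // #B ≤ lam} ≤ #X := by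
    refine (Cardinal.mk_bounded_set_le X lam).trans ?_
    rwa [max_eq_left hX]
  have hXP : #(X × {B : Set X // #B ≤ lam}) ≤ #X := by
    rw [Cardinal.mk_prod, Cardinal.lift_id, Cardinal.lift_id]
    exact (mul_le_mul' le_rfl hP).trans (Cardinal.mul_eq_self hX).le
  obtain ⟨f⟩ := Cardinal.le_def _ _ |>.1 hXP
  have : Infinite X := Cardinal.infinite_iff.2 hX
  have : Nonempty (X × {B : Set X // #B ≤ lam}) := ⟨Classical.arbitrary X, ∅, by simp⟩
  let A : X → Set X := fun x => (Function.invFun f x).2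
  have hAf : ∀ p, A (f p) = p.2 := fun p => by
    simp only [A, Function.leftInverse_invFun f.injective p]
  refine ⟨{x | #(A x) = lam ∧ ∀ a ∈ A x, a < x}, A, fun x hx => hx, fun B hB => ?_⟩
  obtain ⟨β, hβ⟩ : ∃ β, ∀ b ∈ B, b < β := by
    by_contra! hc
    exact (hB.trans_lt hcof).not_ge (Order.cof_le hc)
  -- Of the `#X` indices `f (y, B)`, fewer than `#X` lie below `β`; all others are admissible for
  -- `B`.
  by_contra! hlt
  have hinj : Function.Injective fun y : X => f (y, ⟨B, hB.le⟩) := fun y z h =>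
    congrArg Prod.fst (f.injective h)
  have hsub : Set.range (fun y : X => f (y, ⟨B, hB.le⟩)) ⊆
      {x | (#(A x) = lam ∧ ∀ a ∈ A x, a < x) ∧ A x = B} ∪ Set.Iio β := by
    rintro _ ⟨y, rfl⟩
    rcases lt_or_ge (f (y, ⟨B, hB.le⟩)) β with h | h
    · exact Or.inr h
    · refine Or.inl ⟨?_, hAf _⟩
      rw [hAf]
      exact ⟨hB, fun a ha => (hβ a ha).trans_le h⟩
  have h1 := Cardinal.mk_le_mk_of_subset hsub
  rw [Cardinal.mk_range_eq _ hinj] at h1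
  exact (h1.trans (Cardinal.mk_union_le _ _)).not_gt (Cardinal.add_lt_of_lt hX hlt (hIio β))

/-- Close `{x, y}` under `z ↦ A z` to get `T` of size at most `lam`. On `T`, disjoint members of the
ultrafilters allow `V` to be grown from `x` alone; above that, the ultrafilters dictate `V`. -/
theorem exists_ultrafilter_clopen_separating {X : Type u} [LinearOrder X] [WellFoundedLT X]
    {lam : Cardinal.{u}} (hlam : ℵ₀ ≤ lam) {N : Set X} {A : X → Set X}
    (hA : ∀ z ∈ N, #(A z) ≤ lam) (hlt : ∀ z ∈ N, ∀ a ∈ A z, a < z)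
    {D : X → Ultrafilter X} (hDA : ∀ z ∈ N, A z ∈ D z)
    (hDc : ∀ z ∈ N, ∀ w, {w}ᶜ ∈ D z)
    (hsep : ∀ S ⊆ N, #S ≤ lam → ∃ C : X → Set X, (∀ z ∈ S, C z ∈ D z) ∧ S.PairwiseDisjoint C)
    {x y : X} (hxy : x ≠ y) :
    ∃ V : Set X, (∀ z ∈ N, z ∈ V ↔ V ∈ D z) ∧ x ∈ V ∧ y ∉ V := by
  classical
  let T := reachable (fun z w => z ∈ N ∧ w ∈ A z) {x, y}
  have hT : #T ≤ lam := by
    refine mk_reachable_le hlam ?_ fun z => ?_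
    · exact ((Set.toFinite {x, y}).lt_aleph0.le).trans hlam
    · by_cases hz : z ∈ N
      · simpa [hz] using hA z hz
      · simp [hz]
  have hTA : ∀ z ∈ T, z ∈ N → A z ⊆ T := fun z hz hzN w hw => reachable_tail hz ⟨hzN, hw⟩
  obtain ⟨C₀, hC₀, hC₀d⟩ := hsep (T ∩ N) Set.inter_subset_right
    ((Cardinal.mk_le_mk_of_subset Set.inter_subset_left).trans hT)
  -- Removing `y` keeps it out of `V₀`; removing `x` prevents `C z` with `z ∉ V₀` from meeting `V₀`
  -- at its starting point.
  let C : X → Set X := fun z => C₀ z ∩ A z ∩ ({x}ᶜ ∩ {y}ᶜ)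
  have hC : ∀ z ∈ T ∩ N, C z ∈ D z := fun z hz =>
    Filter.inter_mem (Filter.inter_mem (hC₀ z hz) (hDA z hz.2))
      (Filter.inter_mem (hDc z hz.2 x) (hDc z hz.2 y))
  let V₀ := reachable (fun z w => z ∈ T ∩ N ∧ w ∈ C z) {x}
  have hV₀ : ∀ w ∈ V₀, w = x ∨ ∃ z ∈ T ∩ N, z ∈ V₀ ∧ w ∈ C z := by
    rintro w ⟨x', rfl, hw⟩
    rcases hw.cases_tail with h | ⟨z, hz, hzw⟩
    · exact Or.inl h
    · exact Or.inr ⟨z, hzw.1, ⟨_, rfl, hz⟩, hzw.2⟩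
  have hVin : ∀ z ∈ T ∩ N, z ∈ V₀ → C z ⊆ V₀ := fun z hz hzV w hw => reachable_tail hzV ⟨hz, hw⟩
  have hVout : ∀ z ∈ T ∩ N, z ∉ V₀ → Disjoint (C z) V₀ := by
    intro z hz hzV
    refine Set.disjoint_left.2 fun w hw hwV => ?_
    rcases hV₀ w hwV with rfl | ⟨z', hz', hzV', hw'⟩
    · exact hw.2.1 rfl
    · refine Set.disjoint_left.1 (hC₀d hz hz' ?_) hw.1.1 hw'.1.1
      rintro rfl
      exact hzV hzV'
  -- Outside `T` the recursion may look only below `z`, because `A z ∈ D z` lies there.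
  obtain ⟨W, hW⟩ : ∃ W : X → Prop, ∀ z, W z ↔
      if z ∈ T then z ∈ V₀ else z ∈ N ∧ {w | ∃ _ : w < z, W w} ∈ D z :=
    ⟨(wellFounded_lt (α := X)).fix fun z F =>
      if z ∈ T then z ∈ V₀ else z ∈ N ∧ {w | ∃ h : w < z, F w h} ∈ D z,
      fun z => by rw [WellFounded.fix_eq]⟩
  have hWT : ∀ z ∈ T, (W z ↔ z ∈ V₀) := fun z hz => by rw [hW, if_pos hz]
  refine ⟨{z | W z}, fun z hz => ?_, ?_, ?_⟩
  · by_cases hzT : z ∈ T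
    · rw [Set.mem_ofPred_eq, hWT z hzT]
      have hCT : C z ⊆ T := fun w hw => hTA z hzT hz hw.1.2
      constructor
      · intro hzV
        exact Filter.mem_of_superset (hC z ⟨hzT, hz⟩) fun w hw =>
          (hWT w (hCT hw)).2 (hVin z ⟨hzT, hz⟩ hzV hw)
      · intro hWD
        by_contra hzV
        obtain ⟨w, hw, hw'⟩ := Filter.nonempty_of_mem (Filter.inter_mem hWD (hC z ⟨hzT, hz⟩))
        exact Set.disjoint_left.1 (hVout z ⟨hzT, hz⟩ hzV) hw' ((hWT w (hCT hw')).1 hw)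
    · rw [Set.mem_ofPred_eq, hW, if_neg hzT]
      constructor
      · rintro ⟨-, h⟩
        exact Filter.mem_of_superset h fun w ⟨_, hw⟩ => hw
      · intro h
        exact ⟨hz, Filter.mem_of_superset (Filter.inter_mem h (hDA z hz)) fun w hw =>
          ⟨hlt z hz w hw.2, hw.1⟩⟩
  · exact (hWT x (subset_reachable _ _ (by simp))).2 (subset_reachable _ _ rfl)
  · intro hy
    rcases hV₀ y ((hWT y (subset_reachable _ _ (by simp))).1 hy) with h | ⟨z, -, -, h⟩
    · exact hxy h.symm
    · exact h.2.2 rfl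

/-- A zero-dimensional Hausdorff topology in which given ultrafilters converge. -/
theorem exists_t3Space_of_ultrafilters {X : Type u} {N : Set X} {D : X → Ultrafilter X}
    (h : ∀ x y : X, x ≠ y → ∃ V : Set X, (∀ z ∈ N, z ∈ V ↔ V ∈ D z) ∧ x ∈ V ∧ y ∉ V) :
    ∃ _ : TopologicalSpace X, T3Space X ∧ ∀ z ∈ N, (D z : Filter X) ≤ nhds z := by
  classical
  let f : X → {V : Set X // ∀ z ∈ N, z ∈ V ↔ V ∈ D z} → Bool := fun x V => decide (x ∈ V.1)
  let t : TopologicalSpace X := TopologicalSpace.induced f inferInstance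
  have hf : Topology.IsEmbedding f := ⟨⟨rfl⟩, fun x y hxy => by
    by_contra hne
    obtain ⟨V, hV, hx, hy⟩ := h x y hne
    have := congrFun hxy ⟨V, hV⟩
    simp [f, hx, hy] at this⟩
  refine ⟨t, hf.t3Space, fun z hz => ?_⟩
  rw [nhds_induced, ← Filter.tendsto_iff_comap, tendsto_pi_nhds]
  rintro ⟨V, hV⟩
  refine tendsto_nhds_of_eventually_eq ?_
  by_cases hzV : z ∈ V
  · filter_upwards [(hV z hz).1 hzV] with w hw
    simp [f, hzV, hw]
  · have : Vᶜ ∈ D z := Ultrafilter.compl_mem_iff_notMem.2 fun h => hzV ((hV z hz).2 h)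
    filter_upwards [this] with w hw
    simp [f, hzV, show w ∉ V from hw]

theorem mainTheorem4 (lam : Cardinal.{u}) (hlam : ℵ₀ ≤ lam)
    (κ : Cardinal.{u})
    (hκ : IsLeast {ν : Cardinal.{u} | (2 : Cardinal.{u}) ^ lam < (2 : Cardinal.{u}) ^ ν} κ) :
    ∃ (X : Type u) (_ : TopologicalSpace X),
      T3Space X ∧ #X = (2 : Cardinal.{u}) ^ κ ∧
        ¬ ∃ Y : Set X, IsClosed Y ∧ lam ≤ #Y ∧ #Y < (2 : Cardinal.{u}) ^ κ := by
  have hlt : lam < κ := by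
    by_contra! hle
    exact (Set.mem_ofPred.1 hκ.1).not_ge (Cardinal.power_le_power_left two_ne_zero hle)
  have hle : κ ≤ 2 ^ lam := hκ.2 (Cardinal.cantor _)
  have hκ₀ : ℵ₀ ≤ κ := hlam.trans hlt.le
  let X := ((2 : Cardinal.{u}) ^ κ).ord.ToType
  have hX : #X = 2 ^ κ := Cardinal.mk_ord_toType _
  have hX₀ : ℵ₀ ≤ #X := hX ▸ hκ₀.trans (Cardinal.cantor κ).le
  obtain ⟨N, A, hA, hAN⟩ := exists_indexing_of_subsets (X := X) (lam := lam) hX₀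
    (by rw [hX, ← Cardinal.power_mul, Cardinal.mul_eq_left hκ₀ hlt.le
      (Cardinal.aleph0_pos.trans_le hlam).ne'])
    (fun x => Cardinal.mk_Iio_lt x (by simp [X]))
    (by
      rw [Ordinal.cof_toType]
      exact hlt.trans (Cardinal.lt_cof_ord_power hκ₀ (by norm_num)))
  obtain ⟨E, hE⟩ := exists_isSeparating X hlam X
    (hX ▸ Cardinal.power_le_power_left two_ne_zero hle)
  have hD : ∀ z, ∃ D : Ultrafilter X, z ∈ N → (D : Filter X) ≤ E (A z) z := by
    intro z
    by_cases hz : z ∈ N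
    · have := hE.neBot (A z) z (hA z hz).1.ge
      exact ⟨Ultrafilter.of _, fun _ => Ultrafilter.of_le _⟩
    · exact ⟨pure z, fun h => (hz h).elim⟩
  choose D hD using hD
  have hDA : ∀ z ∈ N, A z ∈ D z := by
    intro z hz
    obtain ⟨B, hB, -, hBE⟩ := hE.small (A z) z (hA z hz).1.ge
    exact Filter.mem_of_superset (hD z hz hBE) hB
  obtain ⟨t, ht, hDt⟩ := exists_t3Space_of_ultrafilters (N := N) (D := D) fun x y hxy =>
    exists_ultrafilter_clopen_separating hlam (fun z hz => (hA z hz).1.le)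
      (fun z hz => (hA z hz).2) hDA
      (fun z hz w => hD z hz (hE.compl_mem (A z) z (hA z hz).1.ge {w}
        ((Set.finite_singleton w).lt_aleph0.trans_le hlam)))
      (fun S hSN hS => by
        obtain ⟨C, hC, hCd⟩ := hE.separates S hS A fun z hz => (hA z (hSN hz)).1.ge
        exact ⟨C, fun z hz => hD z (hSN hz) (hC z hz), hCd⟩) hxy
  refine ⟨X, t, ht, hX, ?_⟩
  rintro ⟨Y, hY, hlamY, hYκ⟩
  -- Every index `x` of `B` is the limit of `D x`, which contains `B ⊆ Y`, so `x ∈ Y`.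
  obtain ⟨B, hBY, hB⟩ := Cardinal.le_mk_iff_exists_subset.1 hlamY
  refine hYκ.not_ge ((hX.symm.le.trans (hAN B hB)).trans (Cardinal.mk_le_mk_of_subset ?_))
  rintro x ⟨hx, rfl⟩
  exact hY.mem_of_tendsto (f := id) (hDt x hx) (Filter.mem_of_superset (hDA x hx) hBY)
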